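/- Let $\mathsf{k}$ be a field, $R$ a unital (associative, not necessarily commutative) $\mathsf{k}$-algebra, and $E=(E^0,E^1,s,r)$ a finite directed graph satisfying condition (L), that is, every cycle $e_1\cdots e_n$ of $E$ has an exit: an edge $f$ with $s(f)=s(e_i)$ and $f\neq e_i$ for some $i$. Let $L_R(E)$ be the Leavitt path algebra of $E$ with coefficients in $R$, i.e. the $R$-algebra (elements of $R$ commuting with the generators) generated by $\{v,e,e^*\mid v\in E^0,\ e\in E^1\}$ subject to $vw=\delta_{v,w}w$; $s(e)e=e=e\,r(e)$ and $r(e)e^*=e^*=e^*s(e)$; $e^*f=\delta_{e,f}\,r(e)$; and $v=\sum_{s(e)=v}ee^*$ for every vertex $v$ that emits at least one edge. It is unital, with $1=\sum_{v\in E^0}v$. Let $L_R(1,2)$ be the unital $R$-algebra (elements of $R$ again commuting with the generators) generated by $x_1,x_2,x_1^*,x_2^*$ subject to $x_1x_1^*+x_2x_2^*=1$ and $x_i^*x_j=\delta_{i,j}$. Then there is an injective ring homomorphism $\varphi\colon L_R(E)\to L_R(1,2)$ that is $R$-linear on both sides, i.e. $\varphi(az)=a\,\varphi(z)$ and $\varphi(za)=\varphi(z)\,a$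 for all $a\in R$, $z\in L_R(E)$, and that is unital, $\varphi(1)=1$, whenever $E^0\neq\emptyset$. -/

import Mathlib

/-- A directed graph with vertex set `V` and edge set `E`: every edge `e` has a source `s e` and a
range `r e` (loops and parallel edges are allowed). -/
structure DirGraph (V E : Type*) where
  /-- the source map -/
  s : E → V
  /-- the range map -/
  r : E → V

namespace DirGraph

variable {V E : Type*}

/-- A path `e₁ ⋯ eₙ` (`n ≥ 1`): a nonempty sequence of edges with `r eᵢ = s eᵢ₊₁`. -/
def IsPath (G : DirGraph V E) (p : List E) : Prop :=
  p ≠ [] ∧ p.IsChain (fun e f => G.r e = G.s f)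

/-- A cycle: a path `e₁ ⋯ eₙ` with `r eₙ = s e₁` that revisits no other vertex, i.e. the
vertices `s e₁, …, s eₙ` are pairwise distinct. -/
def IsCycle (G : DirGraph V E) (p : List E) : Prop :=
  G.IsPath p ∧ (∀ a ∈ p.head?, ∀ b ∈ p.getLast?, G.r b = G.s a) ∧ (p.map G.s).Nodup

/-- The edge `f` is an exit for the path `e₁ ⋯ eₙ` if `s f = s eᵢ` but `f ≠ eᵢ` for some `i`. -/
def IsExit (G : DirGraph V E) (p : List E) (f : E) : Prop :=
  ∃ e ∈ p, G.s f = G.s e ∧ f ≠ e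

/-- Condition (L): every cycle has an exit. -/
def ConditionL (G : DirGraph V E) : Prop :=
  ∀ p : List E, G.IsCycle p → ∃ f : E, G.IsExit p f

end DirGraph

/-- The free associative unital ring on the symbols `X` with coefficients in the (possibly
noncommutative) ring `R`: finite sums `∑ r_w w` over words `w` in `X`, where coefficients commute
with words. -/
abbrev FreeRingOver (R : Type*) [Ring R] (X : Type*) := MonoidAlgebra R (FreeMonoid X)

/-- The symbol `x`, as an element of the free ring. -/
noncomputable def FreeRingOver.gen (R : Type*) [Ring R] {X : Type*} (x : X) : FreeRingOver R X :=
  MonoidAlgebra.single (FreeMonoid.of x) 1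

/-- The generators `v`, `e`, `e*` of a Leavitt path algebra. -/
inductive LPAGen (V E : Type*)
  | vert (v : V)
  | edge (e : E)
  | ghost (e : E)

section LeavittPathAlgebra

open FreeRingOver LPAGen

/-- The defining relations of the Leavitt path algebra of a finite graph. The last one says that
the unit of this algebra is the sum of all vertices: it accounts for the fact that the algebra is
generated by `v, e, e*` as an algebra that is not a priori unital, whereas the quotient is taken
here of a free *unital* ring. -/
inductive LPARel (R : Type*) [Ring R] {V E : Type*} [Fintype V] [DecidableEq V] [Fintype E]
    (G : DirGraph V E) : FreeRingOver R (LPAGen V E) → FreeRingOver R (LPAGen V E) → Prop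
  | vert_mul_self (v : V) : LPARel R G (gen R (vert v) * gen R (vert v)) (gen R (vert v))
  | vert_mul_vert (v w : V) (h : v ≠ w) : LPARel R G (gen R (vert v) * gen R (vert w)) 0
  | source_mul_edge (e : E) :
      LPARel R G (gen R (vert (G.s e)) * gen R (edge e)) (gen R (edge e))
  | edge_mul_range (e : E) :
      LPARel R G (gen R (edge e) * gen R (vert (G.r e))) (gen R (edge e))
  | range_mul_ghost (e : E) :
      LPARel R G (gen R (vert (G.r e)) * gen R (ghost e)) (gen R (ghost e))
  | ghost_mul_source (e : E) :
      LPARel R G (gen R (ghost e) * gen R (vert (G.s e))) (gen R (ghost e))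
  | ghost_mul_edge_self (e : E) :
      LPARel R G (gen R (ghost e) * gen R (edge e)) (gen R (vert (G.r e)))
  | ghost_mul_edge (e f : E) (h : e ≠ f) : LPARel R G (gen R (ghost e) * gen R (edge f)) 0
  | vert_eq_sum (v : V) (h : ∃ e, G.s e = v) :
      LPARel R G (gen R (vert v))
        (∑ e ∈ Finset.univ.filter (fun e => G.s e = v), gen R (edge e) * gen R (ghost e))
  | one_eq_sum : LPARel R G 1 (∑ v : V, gen R (vert v))

/-- The Leavitt path algebra `L_R(E)` of a finite graph, with coefficients in the ring `R`. -/
def LeavittPathAlgebra (R : Type*) [Ring R] {V E : Type*} [Fintype V] [DecidableEq V] [Fintype E]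
    (G : DirGraph V E) := RingQuot (LPARel R G)

noncomputable instance (R : Type*) [Ring R] {V E : Type*} [Fintype V] [DecidableEq V] [Fintype E]
    (G : DirGraph V E) : Ring (LeavittPathAlgebra R G) :=
  inferInstanceAs (Ring (RingQuot (LPARel R G)))

/-- The structure map `R → L_R(E)`. -/
noncomputable def LeavittPathAlgebra.coeff (R : Type*) [Ring R] {V E : Type*} [Fintype V]
    [DecidableEq V] [Fintype E] (G : DirGraph V E) : R →+* LeavittPathAlgebra R G :=
  (RingQuot.mkRingHom (LPARel R G)).comp MonoidAlgebra.singleOneRingHom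

end LeavittPathAlgebra

/-- The generators `x₁, x₂` and `x₁*, x₂*` of the Leavitt algebra `L_R(1,2)`. -/
inductive LeavittGen
  | x (i : Fin 2)
  | xstar (i : Fin 2)

section LeavittAlgebra

open FreeRingOver LeavittGen

/-- The defining relations `x₁ x₁* + x₂ x₂* = 1`, `xᵢ* xᵢ = 1` and `xᵢ* xⱼ = 0` (`i ≠ j`) of the
Leavitt algebra `L_R(1,2)`. -/
inductive LeavittRel (R : Type*) [Ring R] :
    FreeRingOver R LeavittGen → FreeRingOver R LeavittGen → Prop
  | sum_eq_one :
      LeavittRel R (gen R (x 0) * gen R (xstar 0) + gen R (x 1) * gen R (xstar 1)) 1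
  | xstar_mul_x_self (i : Fin 2) : LeavittRel R (gen R (xstar i) * gen R (x i)) 1
  | xstar_mul_x (i j : Fin 2) (h : i ≠ j) : LeavittRel R (gen R (xstar i) * gen R (x j)) 0

/-- The Leavitt algebra `L_R(1,2)` with coefficients in the ring `R`. -/
def LeavittAlgebra (R : Type*) [Ring R] := RingQuot (LeavittRel R)

noncomputable instance (R : Type*) [Ring R] : Ring (LeavittAlgebra R) :=
  inferInstanceAs (Ring (RingQuot (LeavittRel R)))

/-- The structure map `R → L_R(1,2)`. -/
noncomputable def LeavittAlgebra.coeff (R : Type*) [Ring R] : R →+* LeavittAlgebra R :=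
  (RingQuot.mkRingHom (LeavittRel R)).comp MonoidAlgebra.singleOneRingHom

end LeavittAlgebra

/-! Choose a complete prefix code `z` on the vertices and, for each vertex emitting edges, a
complete prefix code `w` on those edges. Identifying words in 0, 1 with monomials in `x₁`, `x₂`,
send `v` to `z_v z_v*`, `e` to `z_{s(e)} w_e z_{r(e)}*`, and `e*` to the mirror image.
Prefix-freeness gives the orthogonality relations, completeness gives the two sum relations.

Injectivity avoids any uniqueness theorem and works over arbitrary `R`. Every element becomes "real"
(free of ghost edges) after right multiplication by long enough paths, and `1` is a sum of elements
`p p*` over such paths, so it suffices to treat real elements (`injective_of_injective_real`). A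
real element times `v` is a combination of walks ending at `v`. A walk `p` from `u` to `v` maps to
`z_u w_p z_v*`; multiplying by `z_v` leaves the monomial `z_u w_p`. Distinct monomials are
independent (`word_linearIndependent`), so distinct walks ending at `v` must have distinct words
(`walkWord_injective`). Decoding from the left could fail only if some nonempty closed walk had an
empty code word. Each of its edges would then be the only one leaving its source, which condition
(L) forbids. -/

/-! ### Free rings over `R`. -/

/-- The ring homomorphism out of the free ring over `R` given by a homomorphism on coefficients and
images of the symbols commuting with it. -/
noncomputable def FreeRingOver.lift {R S X : Type*} [Ring R] [Ring S] (f : R →+* S) (g : X → S)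
    (h : ∀ a x, Commute (f a) (g x)) : FreeRingOver R X →+* S :=
  MonoidAlgebra.liftNCRingHom f (FreeMonoid.lift g) fun a m => by
    induction m using FreeMonoid.inductionOn' with
    | one => simp
    | of_mul x m ih =>
      rw [map_mul, FreeMonoid.lift_eval_of]
      exact (h a x).mul_right ih

lemma FreeRingOver.lift_gen {R S X : Type*} [Ring R] [Ring S] (f : R →+* S) (g : X → S)
    (h : ∀ a x, Commute (f a) (g x)) (x : X) :
    FreeRingOver.lift f g h (FreeRingOver.gen R x) = g x := by
  simp [FreeRingOver.lift, FreeRingOver.gen, MonoidAlgebra.liftNCRingHom]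

lemma FreeRingOver.lift_singleOne {R S X : Type*} [Ring R] [Ring S] (f : R →+* S) (g : X → S)
    (h : ∀ a x, Commute (f a) (g x)) (a : R) :
    FreeRingOver.lift f g h (MonoidAlgebra.singleOneRingHom a) = f a := by
  simp [FreeRingOver.lift, MonoidAlgebra.liftNCRingHom]

lemma FreeRingOver.commute_singleOne_gen {R X : Type*} [Ring R] (a : R) (x : X) :
    Commute (MonoidAlgebra.singleOneRingHom a : FreeRingOver R X) (FreeRingOver.gen R x) := by
  simp [Commute, SemiconjBy, FreeRingOver.gen, MonoidAlgebra.single_mul_single]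

lemma FreeRingOver.mem_of_gen_mem {R X : Type*} [Ring R] (A : Subring (FreeRingOver R X))
    (hc : ∀ a : R, MonoidAlgebra.singleOneRingHom a ∈ A) (hg : ∀ x, FreeRingOver.gen R x ∈ A)
    (y : FreeRingOver R X) : y ∈ A := by
  induction y using MonoidAlgebra.induction_on with
  | of m =>
    induction m using FreeMonoid.inductionOn' with
    | one => exact A.one_mem
    | of_mul x m ih =>
      rw [map_mul]
      exact A.mul_mem (hg x) ih
  | add x y hx hy => exact A.add_mem hx hy
  | smul a x hx =>
    have : a • x = MonoidAlgebra.singleOneRingHom a * x := by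
      ext m
      simp [MonoidAlgebra.coeff_single_one_mul]
    rw [this]
    exact A.mul_mem (hc a) hx

/-! ### Words and prefix codes in the Leavitt algebra. -/

namespace LeavittAlgebra

variable (R : Type*) [Ring R]

/-- The generators `x₁, x₂` of the Leavitt algebra. -/
noncomputable def x (i : Fin 2) : LeavittAlgebra R :=
  RingQuot.mkRingHom (LeavittRel R) (FreeRingOver.gen R (LeavittGen.x i))

/-- The generators `x₁*, x₂*` of the Leavitt algebra. -/
noncomputable def xstar (i : Fin 2) : LeavittAlgebra R :=
  RingQuot.mkRingHom (LeavittRel R) (FreeRingOver.gen R (LeavittGen.xstar i))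

lemma sum_eq_one : x R 0 * xstar R 0 + x R 1 * xstar R 1 = 1 := by
  have h := RingQuot.mkRingHom_rel (LeavittRel.sum_eq_one (R := R))
  rwa [map_add, map_mul, map_mul, map_one] at h

lemma xstar_mul_x_self (i : Fin 2) : xstar R i * x R i = 1 := by
  have h := RingQuot.mkRingHom_rel (LeavittRel.xstar_mul_x_self (R := R) i)
  rwa [map_mul, map_one] at h

lemma xstar_mul_x {i j : Fin 2} (hij : i ≠ j) : xstar R i * x R j = 0 := by
  have h := RingQuot.mkRingHom_rel (LeavittRel.xstar_mul_x (R := R) i j hij)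
  rwa [map_mul, map_zero] at h

variable {R}

lemma commute_coeff_x (a : R) (i : Fin 2) : Commute (coeff R a) (x R i) :=
  (FreeRingOver.commute_singleOne_gen a (LeavittGen.x i)).map (RingQuot.mkRingHom (LeavittRel R))

lemma commute_coeff_xstar (a : R) (i : Fin 2) : Commute (coeff R a) (xstar R i) :=
  (FreeRingOver.commute_singleOne_gen a (LeavittGen.xstar i)).map
    (RingQuot.mkRingHom (LeavittRel R))

variable (R)

/-- The monomial `x_{i₁} ⋯ x_{iₙ}`. -/
noncomputable def word (l : List (Fin 2)) : LeavittAlgebra R := (l.map (x R)).prod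

/-- The monomial `x_{iₙ}* ⋯ x_{i₁}*`. -/
noncomputable def wordStar : List (Fin 2) → LeavittAlgebra R
  | [] => 1
  | i :: l => wordStar l * xstar R i

@[simp] lemma word_nil : word R [] = 1 := rfl

@[simp] lemma wordStar_nil : wordStar R [] = 1 := rfl

lemma word_cons (i : Fin 2) (l : List (Fin 2)) : word R (i :: l) = x R i * word R l := by
  simp [word]

lemma wordStar_cons (i : Fin 2) (l : List (Fin 2)) :
    wordStar R (i :: l) = wordStar R l * xstar R i := rfl

lemma word_append (l m : List (Fin 2)) : word R (l ++ m) = word R l * word R m := by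
  simp [word]

lemma wordStar_mul_word_self (l : List (Fin 2)) : wordStar R l * word R l = 1 := by
  induction l with
  | nil => simp
  | cons i l ih =>
    rw [word_cons, wordStar_cons, mul_assoc, ← mul_assoc (xstar R i), xstar_mul_x_self, one_mul, ih]

/-- Common letters cancel until the first disagreement, which exists because neither word is a
prefix of the other. -/
lemma wordStar_mul_word {l m : List (Fin 2)} (h₁ : ¬ l <+: m) (h₂ : ¬ m <+: l) :
    wordStar R l * word R m = 0 := by
  induction l generalizing m with
  | nil => exact absurd (List.nil_prefix) h₁
  | cons i l ih =>
    cases m with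
    | nil => exact absurd (List.nil_prefix) h₂
    | cons j m =>
      rw [word_cons, wordStar_cons, mul_assoc, ← mul_assoc (xstar R i)]
      by_cases hij : i = j
      · subst hij
        rw [xstar_mul_x_self, one_mul]
        exact ih (by simpa [List.cons_prefix_cons] using h₁)
          (by simpa [List.cons_prefix_cons] using h₂)
      · rw [xstar_mul_x R hij, zero_mul, mul_zero]

variable {R}

lemma commute_coeff_word (a : R) (l : List (Fin 2)) : Commute (coeff R a) (word R l) := by
  induction l with
  | nil => exact Commute.one_right _
  | cons i l ih =>
    rw [word_cons]
    exact (commute_coeff_x a i).mul_right ih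

lemma commute_coeff_wordStar (a : R) (l : List (Fin 2)) :
    Commute (coeff R a) (wordStar R l) := by
  induction l with
  | nil => exact Commute.one_right _
  | cons i l ih =>
    rw [wordStar_cons]
    exact ih.mul_right (commute_coeff_xstar a i)

variable (R)

/-- The code is `0, 10, 110, …`, closed off by a word of `1`s only; a one-element code is the empty
word. Completeness is inherited through `x₁ x₁* + x₂ x₂* = 1`. -/
lemma exists_code_fin (n : ℕ) : ∃ c : Fin (n + 1) → List (Fin 2),
    (∀ i j, c i <+: c j → i = j) ∧ ∑ i, word R (c i) * wordStar R (c i) = 1 := by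
  induction n with
  | zero => exact ⟨fun _ => [], fun i j _ => Fin.ext (by omega), by simp⟩
  | succ n ih =>
    obtain ⟨c, hc, hs⟩ := ih
    refine ⟨Fin.cons [0] fun i => 1 :: c i, fun i j => ?_, ?_⟩
    · refine Fin.cases ?_ (fun i => ?_) i <;> refine Fin.cases ?_ (fun j => ?_) j
      · simp
      · simp [List.cons_prefix_cons]
      · simp [List.cons_prefix_cons]
      · intro h
        simp only [Fin.cons_succ, List.cons_prefix_cons, true_and] at h
        rw [hc i j h]
    · rw [Fin.sum_univ_succ]
      simp only [Fin.cons_zero, Fin.cons_succ, word_cons, wordStar_cons, word_nil, wordStar_nil,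
        mul_one, one_mul]
      have : ∀ i, x R 1 * word R (c i) * (wordStar R (c i) * xstar R 1) =
          x R 1 * (word R (c i) * wordStar R (c i)) * xstar R 1 := fun i => by
        simp only [mul_assoc]
      rw [Finset.sum_congr rfl fun i _ => this i, ← Finset.sum_mul, ← Finset.mul_sum, hs, mul_one,
        sum_eq_one]

/-- Every nonempty finite type indexes a complete prefix code. -/
lemma exists_code (ι : Type*) [Fintype ι] [Nonempty ι] : ∃ c : ι → List (Fin 2),
    (∀ i j, c i <+: c j → i = j) ∧ ∑ i, word R (c i) * wordStar R (c i) = 1 := by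
  obtain ⟨n, hn⟩ : ∃ n, Fintype.card ι = n + 1 := Nat.exists_eq_succ_of_ne_zero Fintype.card_ne_zero
  obtain ⟨c, hc, hs⟩ := exists_code_fin R n
  let e : ι ≃ Fin (n + 1) := Fintype.equivFinOfCardEq hn
  refine ⟨fun i => c (e i), fun i j h => e.injective (hc _ _ h), ?_⟩
  rw [← hs]
  exact e.sum_comp fun i => word R (c i) * wordStar R (c i)

/-! ### Independence of words, via a representation on sequences. -/

/-- The operator on `ℕ → R` sending the indicator of `n` to that of `2 n + i`. -/
def shift (i : Fin 2) : Module.End ℤ (ℕ → R) where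
  toFun f n := if n % 2 = i then f (n / 2) else 0
  map_add' f g := by
    ext n
    by_cases h : n % 2 = i <;> simp [h]
  map_smul' k f := by
    ext n
    by_cases h : n % 2 = i <;> simp [h]

/-- The operator on `ℕ → R` left inverse to `shift R i`. -/
def unshift (i : Fin 2) : Module.End ℤ (ℕ → R) where
  toFun f n := f (2 * n + i)
  map_add' _ _ := rfl
  map_smul' _ _ := rfl

/-- Coefficientwise left multiplication on `ℕ → R`. -/
def scale : R →+* Module.End ℤ (ℕ → R) where
  toFun a :=
    { toFun := fun f n => a * f n
      map_add' := fun _ _ => funext fun _ => mul_add _ _ _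
      map_smul' := fun k f => funext fun n => mul_smul_comm k a (f n) }
  map_one' := LinearMap.ext fun _ => funext fun _ => one_mul _
  map_mul' _ _ := LinearMap.ext fun _ => funext fun _ => mul_assoc _ _ _
  map_zero' := LinearMap.ext fun _ => funext fun _ => zero_mul _
  map_add' _ _ := LinearMap.ext fun _ => funext fun _ => add_mul _ _ _

lemma shift_apply (i : Fin 2) (f : ℕ → R) (n : ℕ) :
    shift R i f n = if n % 2 = i then f (n / 2) else 0 := rfl

lemma unshift_apply (i : Fin 2) (f : ℕ → R) (n : ℕ) : unshift R i f n = f (2 * n + i) := rfl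

lemma scale_apply (a : R) (f : ℕ → R) (n : ℕ) : scale R a f n = a * f n := rfl

/-- The images of the generators in the representation on `ℕ → R`. -/
def repGen : LeavittGen → Module.End ℤ (ℕ → R)
  | .x i => shift R i
  | .xstar i => unshift R i

lemma commute_scale_repGen (a : R) (y : LeavittGen) : Commute (scale R a) (repGen R y) := by
  cases y with
  | x i =>
    refine LinearMap.ext fun f => funext fun n => ?_
    simp only [Module.End.mul_apply, repGen, shift_apply, scale_apply]
    split_ifs <;> simp
  | xstar i => exact LinearMap.ext fun f => rfl

/-- The representation of the Leavitt algebra on `ℕ → R` in which `xᵢ` sends the indicator of `n`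
to that of `2 n + i`. -/
noncomputable def rep : LeavittAlgebra R →+* Module.End ℤ (ℕ → R) :=
  RingQuot.lift ⟨FreeRingOver.lift (scale R) (repGen R) (commute_scale_repGen R), by
    intro y z h
    induction h with
    | sum_eq_one =>
      simp only [map_add, map_mul, map_one, FreeRingOver.lift_gen, repGen]
      refine LinearMap.ext fun f => funext fun n => ?_
      simp only [LinearMap.add_apply, Module.End.mul_apply,
        Pi.add_apply, shift_apply, unshift_apply, Module.End.one_apply]
      rcases Nat.mod_two_eq_zero_or_one n with h | h
      · have h' : 2 * (n / 2) = n := by omega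
        simp [h, h']
      · have h' : 2 * (n / 2) + 1 = n := by omega
        simp [h, h']
    | xstar_mul_x_self i =>
      simp only [map_mul, map_one, FreeRingOver.lift_gen, repGen]
      refine LinearMap.ext fun f => funext fun n => ?_
      have h₁ : (2 * n + (i : ℕ)) % 2 = i := by omega
      have h₂ : (2 * n + (i : ℕ)) / 2 = n := by omega
      simp [shift_apply, unshift_apply, h₁, h₂]
    | xstar_mul_x i j hij =>
      simp only [map_mul, map_zero, FreeRingOver.lift_gen, repGen]
      refine LinearMap.ext fun f => funext fun n => ?_
      have h₁ : (2 * n + (i : ℕ)) % 2 ≠ j := by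
        have := Fin.val_ne_of_ne hij
        omega
      rw [Module.End.mul_apply, unshift_apply, shift_apply, if_neg h₁]
      rfl⟩

lemma rep_x (i : Fin 2) : rep R (x R i) = shift R i :=
  (RingQuot.lift_mkRingHom_apply _ _ _).trans (FreeRingOver.lift_gen ..)

lemma rep_coeff (a : R) : rep R (coeff R a) = scale R a :=
  (RingQuot.lift_mkRingHom_apply _ _ _).trans (FreeRingOver.lift_singleOne ..)

/-- The number whose binary digits after the leading `1` are the letters of a word, read from its
end. -/
def wordNum : List (Fin 2) → ℕ
  | [] => 1
  | i :: l => 2 * wordNum l + i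

lemma wordNum_pos (l : List (Fin 2)) : 0 < wordNum l := by
  induction l with
  | nil => exact Nat.one_pos
  | cons i l ih =>
    rw [wordNum]
    omega

/-- Parity recovers the first letter, and only the empty word has value `1`. -/
lemma wordNum_injective : Function.Injective wordNum := by
  intro l
  induction l with
  | nil =>
    rintro (_ | ⟨j, m⟩) h
    · rfl
    · have := wordNum_pos m
      simp only [wordNum] at h
      omega
  | cons i l ih =>
    rintro (_ | ⟨j, m⟩) h
    · have := wordNum_pos l
      simp only [wordNum] at h
      omega
    · simp only [wordNum] at h
      have h₁ : i = j := Fin.ext (by omega)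
      rw [h₁, ih (a₂ := m) (by omega)]

lemma rep_word_single (l : List (Fin 2)) :
    rep R (word R l) (Pi.single 1 1) = Pi.single (wordNum l) 1 := by
  induction l with
  | nil => simp [wordNum]
  | cons i l ih =>
    rw [word_cons, map_mul, Module.End.mul_apply, ih, rep_x]
    funext n
    rw [shift_apply, wordNum]
    simp only [Pi.single_apply]
    split_ifs <;> first | rfl | omega

/-- Distinct words are linearly independent in the Leavitt algebra. -/
lemma word_linearIndependent {ι : Type*} (c : ι → List (Fin 2)) (hc : Function.Injective c)
    (f : ι →₀ R) (hf : (f.sum fun i a => coeff R a * word R (c i)) = 0) : f = 0 := by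
  ext i
  -- Acting on the indicator of `1` turns words into indicators of distinct numbers, so this
  -- coordinate isolates `f i`.
  have h := congrFun (congrArg (fun y => rep R y (Pi.single 1 1)) hf) (wordNum (c i))
  simp only [Finsupp.sum, map_sum, map_mul, LinearMap.sum_apply, Module.End.mul_apply, rep_word_single, rep_coeff, Finset.sum_apply, scale_apply, map_zero,
    LinearMap.zero_apply, Pi.zero_apply] at h
  rw [Finset.sum_eq_single i] at h
  · simpa using h
  · intro j _ hj
    rw [Pi.single_eq_of_ne, mul_zero]
    exact fun hij => hj (hc (wordNum_injective hij)).symm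
  · intro hi
    simp [Finsupp.notMem_support_iff.mp hi]

end LeavittAlgebra

/-! ### Walks and condition (L). -/

namespace DirGraph

variable {V E : Type*} (G : DirGraph V E)

/-- The sequence of edges `p`, possibly empty, is a walk from `u` to `v`. -/
def IsWalk : V → List E → V → Prop
  | u, [], v => u = v
  | u, e :: p, v => G.s e = u ∧ IsWalk (G.r e) p v

variable {G}

lemma isWalk_append {u v : V} {p q : List E} :
    G.IsWalk u (p ++ q) v ↔ ∃ m, G.IsWalk u p m ∧ G.IsWalk m q v := by
  induction p generalizing u with
  | nil => simp [IsWalk]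
  | cons e p ih => simp [IsWalk, ih, and_assoc]

lemma IsWalk.isChain {u v : V} {p : List E} (h : G.IsWalk u p v) :
    p.IsChain (fun e f => G.r e = G.s f) := by
  induction p generalizing u with
  | nil => exact List.isChain_nil
  | cons e p ih =>
    obtain ⟨-, h⟩ := h
    refine List.isChain_cons.mpr ⟨fun f hf => ?_, ih h⟩
    cases p with
    | nil => simp at hf
    | cons g p =>
      simp only [List.head?_cons, Option.mem_def, Option.some.injEq] at hf
      subst hf
      exact h.1.symm

lemma IsWalk.range_getLast {u v : V} {p : List E} (h : G.IsWalk u p v) :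
    ∀ e ∈ p.getLast?, G.r e = v := by
  induction p generalizing u with
  | nil => simp
  | cons e p ih =>
    obtain ⟨-, h⟩ := h
    cases p with
    | nil =>
      intro f hf
      simp only [List.getLast?_singleton, Option.mem_def, Option.some.injEq] at hf
      exact hf ▸ h
    | cons g p =>
      intro f hf
      exact ih h f (by simpa [List.getLast?_cons_cons] using hf)

lemma IsWalk.source_head {u v : V} {p : List E} (h : G.IsWalk u p v) :
    ∀ e ∈ p.head?, G.s e = u := by
  cases p with
  | nil => simp
  | cons e p =>
    intro f hf
    simp only [List.head?_cons, Option.mem_def, Option.some.injEq] at hf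
    exact hf ▸ h.1

/-- Under condition (L), every nonempty closed walk meets a vertex emitting two edges. -/
lemma ConditionL.exists_ne_source_eq (hL : G.ConditionL) {v : V} {p : List E} (hp : p ≠ [])
    (h : G.IsWalk v p v) : ∃ e ∈ p, ∃ f, G.s f = G.s e ∧ f ≠ e := by
  induction hn : p.length using Nat.strong_induction_on generalizing p v with
  | _ n ih =>
    subst hn
    by_cases hd : (p.map G.s).Nodup
    · have hc : G.IsCycle p :=
        ⟨⟨hp, h.isChain⟩,
          fun a ha b hb => (h.range_getLast b hb).trans (h.source_head a ha).symm, hd⟩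
      obtain ⟨f, e, he, hf⟩ := hL p hc
      exact ⟨e, he, f, hf⟩
    -- If a source repeats, the segment from its first occurrence up to the second is a shorter
    -- nonempty closed walk.
    · rw [List.Nodup, List.pairwise_map, List.pairwise_iff_forall_sublist] at hd
      push Not at hd
      obtain ⟨e, f, hs, hef⟩ := hd
      obtain ⟨l₁, l₂, rfl, he, hf⟩ := List.cons_sublist_iff.mp hs
      obtain ⟨a, b, rfl⟩ := List.append_of_mem he
      obtain ⟨c, d, rfl⟩ := List.append_of_mem (List.singleton_sublist.mp hf)
      have hw : G.IsWalk v (a ++ ((e :: (b ++ c)) ++ f :: d)) v := by simpa using h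
      obtain ⟨m, -, hw⟩ := isWalk_append.mp hw
      obtain ⟨m', hw, hw'⟩ := isWalk_append.mp hw
      have hm : G.s e = m := hw.1
      have hm' : G.s f = m' := hw'.1
      rw [← hm, ← hm', ← hef] at hw
      obtain ⟨g, hg, hx⟩ := ih (e :: (b ++ c)).length
        (by simp only [List.length_append, List.length_cons]; omega) (by simp) hw rfl
      refine ⟨g, ?_, hx⟩
      simp only [List.mem_cons, List.mem_append] at hg ⊢
      tauto

end DirGraph

/-! ### Prefix codings of a graph. -/

/-- Complete prefix codes on the vertices of `G`, and on the edges emitted by each vertex. -/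
structure PrefixCoding (R : Type*) [Ring R] {V E : Type*} [Fintype V] [DecidableEq V] [Fintype E]
    (G : DirGraph V E) where
  /-- the code word of a vertex -/
  z : V → List (Fin 2)
  /-- the code word of an edge -/
  w : E → List (Fin 2)
  z_prefix : ∀ u v, z u <+: z v → u = v
  w_prefix : ∀ e f, G.s e = G.s f → w e <+: w f → e = f
  sum_z : ∑ v, LeavittAlgebra.word R (z v) * LeavittAlgebra.wordStar R (z v) = 1
  sum_w : ∀ v, (∃ e, G.s e = v) → ∑ e ∈ Finset.univ.filter (fun e => G.s e = v),
    LeavittAlgebra.word R (w e) * LeavittAlgebra.wordStar R (w e) = 1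

namespace PrefixCoding

open LeavittAlgebra

variable {R : Type*} [Ring R] {V E : Type*} [Fintype V] [DecidableEq V] [Fintype E]
  {G : DirGraph V E}

lemma exists_prefixCoding [Nonempty V] : Nonempty (PrefixCoding R G) := by
  obtain ⟨z, hz, hzs⟩ := exists_code R V
  have h : ∀ v, ∃ c : {e // G.s e = v} → List (Fin 2), (∀ i j, c i <+: c j → i = j) ∧
      ((∃ e, G.s e = v) → ∑ i, word R (c i) * wordStar R (c i) = 1) := fun v => by
    by_cases hv : ∃ e, G.s e = v
    · have : Nonempty {e // G.s e = v} := let ⟨e, he⟩ := hv; ⟨⟨e, he⟩⟩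
      obtain ⟨c, hc, hs⟩ := exists_code R {e // G.s e = v}
      exact ⟨c, hc, fun _ => hs⟩
    -- At a sink there are no edges to encode, so the value is irrelevant.
    · exact ⟨fun _ => [], fun i => absurd ⟨i.1, i.2⟩ hv, fun h => absurd h hv⟩
  choose c hc hs using h
  refine ⟨⟨z, fun e => c (G.s e) ⟨e, rfl⟩, hz, ?_, hzs, ?_⟩⟩
  · intro e f hef hp
    -- The codes of `e` and `f` live over propositionally equal sources; a free `v` lets both be
    -- compared in one code.
    have hq : ∀ v (he : G.s e = v) (hf : G.s f = v), c v ⟨e, he⟩ <+: c v ⟨f, hf⟩ → e = f :=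
      fun v he hf h => congrArg Subtype.val (hc v _ _ h)
    refine hq (G.s e) rfl hef.symm (hp.trans (List.prefix_rfl.trans ?_))
    have : ∀ v (hv : G.s f = v), c (G.s f) ⟨f, rfl⟩ = c v ⟨f, hv⟩ := by
      rintro _ rfl
      rfl
    rw [this _ hef.symm]
  · intro v hv
    rw [← hs v hv, Finset.sum_subtype (p := fun e => G.s e = v) _ (by simp)]
    refine Finset.sum_congr rfl fun e _ => ?_
    obtain ⟨e, rfl⟩ := e
    rfl

variable (C : PrefixCoding R G)

lemma wordStar_z_mul_word_z {u v : V} (h : u ≠ v) :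
    wordStar R (C.z u) * word R (C.z v) = 0 :=
  wordStar_mul_word R (fun hp => h (C.z_prefix _ _ hp)) fun hp => h (C.z_prefix _ _ hp).symm

lemma wordStar_w_mul_word_w {e f : E} (hs : G.s e = G.s f) (h : e ≠ f) :
    wordStar R (C.w e) * word R (C.w f) = 0 :=
  wordStar_mul_word R (fun hp => h (C.w_prefix _ _ hs hp))
    fun hp => h (C.w_prefix _ _ hs.symm hp).symm

/-- The code word of a sequence of edges. -/
def pathWord (p : List E) : List (Fin 2) := p.flatMap C.w

/-- An empty edge code is a prefix of every other code at the same source, so it excludes a second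
edge there; condition (L) provides one. -/
lemma pathWord_ne_nil (hL : G.ConditionL) {v : V} {p : List E} (hp : p ≠ [])
    (h : G.IsWalk v p v) : C.pathWord p ≠ [] := by
  intro h0
  obtain ⟨e, he, f, hs, hne⟩ := hL.exists_ne_source_eq hp h
  have hw : C.w e = [] := List.flatMap_eq_nil_iff.mp h0 e he
  exact hne (C.w_prefix e f hs.symm (hw ▸ List.nil_prefix)).symm

/-- Edge codes at a common source are prefix-free, so the words determine the walks edge by edge. If
one walk ends first, the rest of the other is a closed walk at `v` with empty word. -/
lemma pathWord_injective (hL : G.ConditionL) {u v : V} {p q : List E} (hp : G.IsWalk u p v)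
    (hq : G.IsWalk u q v) (h : C.pathWord p = C.pathWord q) : p = q := by
  induction p generalizing u q with
  | nil =>
    by_contra hne
    obtain rfl : u = v := hp
    exact C.pathWord_ne_nil hL (Ne.symm hne) hq h.symm
  | cons e p ih =>
    cases q with
    | nil =>
      obtain rfl : u = v := hq
      exact absurd h (C.pathWord_ne_nil hL (List.cons_ne_nil e p) hp)
    | cons f q =>
      have hs : G.s e = G.s f := hp.1.trans hq.1.symm
      simp only [pathWord, List.flatMap_cons] at h
      have hef : e = f := by
        rcases List.prefix_or_prefix_of_prefix (List.prefix_append (C.w e) _)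
          (h ▸ List.prefix_append (C.w f) _) with hx | hx
        · exact C.w_prefix _ _ hs hx
        · exact (C.w_prefix _ _ hs.symm hx).symm
      subst hef
      rw [ih hp.2 hq.2 (List.append_cancel_left h)]

/-- Under condition (L), the walks ending at a fixed vertex have distinct code words. -/
lemma walkWord_injective (hL : G.ConditionL) (v : V) :
    Function.Injective fun q : {q : V × List E // G.IsWalk q.1 q.2 v} =>
      C.z q.1.1 ++ C.pathWord q.1.2 := by
  rintro ⟨⟨u, p⟩, hp⟩ ⟨⟨u', p'⟩, hp'⟩ h
  simp only at h hp hp'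
  have hu : u = u' := by
    rcases List.prefix_or_prefix_of_prefix (List.prefix_append (C.z u) _)
      (h ▸ List.prefix_append (C.z u') _) with hx | hx
    · exact C.z_prefix _ _ hx
    · exact (C.z_prefix _ _ hx).symm
  subst hu
  obtain rfl := C.pathWord_injective hL hp hp' (List.append_cancel_left h)
  rfl

/-! ### The homomorphism of a prefix coding. -/

/-- The images of the generators of the Leavitt path algebra in `L_R(1,2)`. -/
noncomputable def genImage : LPAGen V E → LeavittAlgebra R
  | .vert v => word R (C.z v) * wordStar R (C.z v)
  | .edge e => word R (C.z (G.s e)) * (word R (C.w e) * wordStar R (C.z (G.r e)))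
  | .ghost e => word R (C.z (G.r e)) * (wordStar R (C.w e) * wordStar R (C.z (G.s e)))

lemma commute_coeff_genImage (a : R) (y : LPAGen V E) : Commute (coeff R a) (C.genImage y) := by
  cases y with
  | vert v => exact (commute_coeff_word a _).mul_right (commute_coeff_wordStar a _)
  | edge e =>
    exact (commute_coeff_word a _).mul_right
      ((commute_coeff_word a _).mul_right (commute_coeff_wordStar a _))
  | ghost e =>
    exact (commute_coeff_word a _).mul_right
      ((commute_coeff_wordStar a _).mul_right (commute_coeff_wordStar a _))

lemma wordStar_mul_word_mul_self (l : List (Fin 2)) (y : LeavittAlgebra R) :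
    wordStar R l * (word R l * y) = y := by
  rw [← mul_assoc, wordStar_mul_word_self, one_mul]

lemma wordStar_z_mul_word_z_mul {u v : V} (h : u ≠ v) (y : LeavittAlgebra R) :
    wordStar R (C.z u) * (word R (C.z v) * y) = 0 := by
  rw [← mul_assoc, C.wordStar_z_mul_word_z h, zero_mul]

/-- The homomorphism `L_R(E) → L_R(1,2)` defined by a prefix coding. -/
noncomputable def hom : LeavittPathAlgebra R G →+* LeavittAlgebra R :=
  RingQuot.lift ⟨FreeRingOver.lift (coeff R) C.genImage C.commute_coeff_genImage, by
    intro y y' h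
    induction h with
    | vert_mul_self v =>
      simp only [map_mul, FreeRingOver.lift_gen, genImage, mul_assoc, wordStar_mul_word_mul_self]
    | vert_mul_vert v w h =>
      simp only [map_mul, map_zero, FreeRingOver.lift_gen, genImage, mul_assoc,
        C.wordStar_z_mul_word_z_mul h, mul_zero]
    | source_mul_edge e =>
      simp only [map_mul, FreeRingOver.lift_gen, genImage, mul_assoc, wordStar_mul_word_mul_self]
    | edge_mul_range e =>
      simp only [map_mul, FreeRingOver.lift_gen, genImage, mul_assoc, wordStar_mul_word_mul_self]
    | range_mul_ghost e =>
      simp only [map_mul, FreeRingOver.lift_gen, genImage, mul_assoc, wordStar_mul_word_mul_self]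
    | ghost_mul_source e =>
      simp only [map_mul, FreeRingOver.lift_gen, genImage, mul_assoc, wordStar_mul_word_mul_self]
    | ghost_mul_edge_self e =>
      simp only [map_mul, FreeRingOver.lift_gen, genImage, mul_assoc, wordStar_mul_word_mul_self]
    | ghost_mul_edge e f h =>
      simp only [map_mul, map_zero, FreeRingOver.lift_gen, genImage, mul_assoc]
      -- Edges with a common source are separated by their edge codes, the others by the vertex
      -- codes of their sources.
      by_cases hs : G.s e = G.s f
      · rw [hs, wordStar_mul_word_mul_self, ← mul_assoc (wordStar R (C.w e)),
          C.wordStar_w_mul_word_w hs h, zero_mul, mul_zero]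
      · rw [C.wordStar_z_mul_word_z_mul hs, mul_zero, mul_zero]
    | vert_eq_sum v h =>
      simp only [map_sum, map_mul, FreeRingOver.lift_gen, genImage, mul_assoc,
        wordStar_mul_word_mul_self]
      have : ∀ e ∈ Finset.univ.filter (fun e => G.s e = v),
          word R (C.z (G.s e)) * (word R (C.w e) * (wordStar R (C.w e) *
            wordStar R (C.z (G.s e)))) =
          word R (C.z v) * (word R (C.w e) * wordStar R (C.w e)) * wordStar R (C.z v) := by
        intro e he
        rw [(Finset.mem_filter.mp he).2]
        simp only [mul_assoc]
      rw [Finset.sum_congr rfl this, ← Finset.sum_mul, ← Finset.mul_sum, C.sum_w v h, mul_one]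
    | one_eq_sum =>
      simp only [map_sum, map_one, FreeRingOver.lift_gen, genImage, C.sum_z]⟩

lemma hom_mk_gen (y : LPAGen V E) :
    C.hom (RingQuot.mkRingHom (LPARel R G) (FreeRingOver.gen R y)) = C.genImage y :=
  (RingQuot.lift_mkRingHom_apply _ _ _).trans (FreeRingOver.lift_gen ..)

lemma hom_coeff (a : R) : C.hom (LeavittPathAlgebra.coeff R G a) = coeff R a :=
  (RingQuot.lift_mkRingHom_apply _ _ _).trans (FreeRingOver.lift_singleOne ..)

end PrefixCoding

/-! ### Relations in the Leavitt path algebra. -/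

namespace LeavittPathAlgebra

variable (R : Type*) [Ring R] {V E : Type*} [Fintype V] [DecidableEq V] [Fintype E]
  (G : DirGraph V E)

/-- A vertex, as an element of the Leavitt path algebra. -/
noncomputable def vert (v : V) : LeavittPathAlgebra R G :=
  RingQuot.mkRingHom (LPARel R G) (FreeRingOver.gen R (LPAGen.vert v))

/-- An edge, as an element of the Leavitt path algebra. -/
noncomputable def edge (e : E) : LeavittPathAlgebra R G :=
  RingQuot.mkRingHom (LPARel R G) (FreeRingOver.gen R (LPAGen.edge e))

/-- A ghost edge, as an element of the Leavitt path algebra. -/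
noncomputable def ghost (e : E) : LeavittPathAlgebra R G :=
  RingQuot.mkRingHom (LPARel R G) (FreeRingOver.gen R (LPAGen.ghost e))

lemma vert_mul_self (v : V) : vert R G v * vert R G v = vert R G v := by
  have h := RingQuot.mkRingHom_rel (LPARel.vert_mul_self (R := R) (G := G) v)
  rwa [map_mul] at h

lemma vert_mul_vert {v w : V} (hvw : v ≠ w) : vert R G v * vert R G w = 0 := by
  have h := RingQuot.mkRingHom_rel (LPARel.vert_mul_vert (R := R) (G := G) v w hvw)
  rwa [map_mul, map_zero] at h

lemma source_mul_edge (e : E) : vert R G (G.s e) * edge R G e = edge R G e := by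
  have h := RingQuot.mkRingHom_rel (LPARel.source_mul_edge (R := R) (G := G) e)
  rwa [map_mul] at h

lemma edge_mul_range (e : E) : edge R G e * vert R G (G.r e) = edge R G e := by
  have h := RingQuot.mkRingHom_rel (LPARel.edge_mul_range (R := R) (G := G) e)
  rwa [map_mul] at h

lemma ghost_mul_source (e : E) : ghost R G e * vert R G (G.s e) = ghost R G e := by
  have h := RingQuot.mkRingHom_rel (LPARel.ghost_mul_source (R := R) (G := G) e)
  rwa [map_mul] at h

lemma ghost_mul_edge_self (e : E) : ghost R G e * edge R G e = vert R G (G.r e) := by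
  have h := RingQuot.mkRingHom_rel (LPARel.ghost_mul_edge_self (R := R) (G := G) e)
  rwa [map_mul] at h

lemma ghost_mul_edge {e f : E} (hef : e ≠ f) : ghost R G e * edge R G f = 0 := by
  have h := RingQuot.mkRingHom_rel (LPARel.ghost_mul_edge (R := R) (G := G) e f hef)
  rwa [map_mul, map_zero] at h

lemma vert_eq_sum {v : V} (hv : ∃ e, G.s e = v) : vert R G v =
    ∑ e ∈ Finset.univ.filter (fun e => G.s e = v), edge R G e * ghost R G e := by
  have h := RingQuot.mkRingHom_rel (LPARel.vert_eq_sum (R := R) (G := G) v hv)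
  rw [map_sum] at h
  simp only [map_mul] at h
  exact h

lemma one_eq_sum : (1 : LeavittPathAlgebra R G) = ∑ v, vert R G v := by
  have h := RingQuot.mkRingHom_rel (LPARel.one_eq_sum (R := R) (G := G))
  rwa [map_sum, map_one] at h

variable {R G}

lemma ghost_mul_vert {e : E} {v : V} (h : G.s e ≠ v) : ghost R G e * vert R G v = 0 := by
  rw [← ghost_mul_source, mul_assoc, vert_mul_vert R G h, mul_zero]

lemma edge_mul_vert {e : E} {v : V} (h : G.r e ≠ v) : edge R G e * vert R G v = 0 := by
  rw [← edge_mul_range, mul_assoc, vert_mul_vert R G h, mul_zero]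

lemma commute_coeff_mk_gen (a : R) (y : LPAGen V E) : Commute (coeff R G a)
    (RingQuot.mkRingHom (LPARel R G) (FreeRingOver.gen R y) : LeavittPathAlgebra R G) :=
  (FreeRingOver.commute_singleOne_gen a y).map (RingQuot.mkRingHom (LPARel R G))

lemma commute_coeff_vert (a : R) (v : V) : Commute (coeff R G a) (vert R G v) :=
  commute_coeff_mk_gen a _

lemma commute_coeff_edge (a : R) (e : E) : Commute (coeff R G a) (edge R G e) :=
  commute_coeff_mk_gen a _

lemma commute_coeff_ghost (a : R) (e : E) : Commute (coeff R G a) (ghost R G e) :=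
  commute_coeff_mk_gen a _

lemma mem_of_generators_mem (A : Subring (LeavittPathAlgebra R G)) (hc : ∀ a, coeff R G a ∈ A)
    (hv : ∀ v, vert R G v ∈ A) (he : ∀ e, edge R G e ∈ A) (hg : ∀ e, ghost R G e ∈ A)
    (y : LeavittPathAlgebra R G) : y ∈ A := by
  obtain ⟨y, rfl⟩ := RingQuot.mkRingHom_surjective (LPARel R G) y
  refine FreeRingOver.mem_of_gen_mem (A.comap (RingQuot.mkRingHom (LPARel R G))) hc ?_ y
  rintro (v | e | e)
  exacts [hv v, he e, hg e]

/-! ### Reduction of injectivity to real elements. -/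

variable (R G)

/-- The subring of the Leavitt path algebra generated by coefficients, vertices and (real) edges. -/
noncomputable def realSubring : Subring (LeavittPathAlgebra R G) :=
  Subring.closure (Set.range (coeff R G) ∪ (Set.range (vert R G) ∪ Set.range (edge R G)))

variable {R G}

lemma coeff_mem_real (a : R) : coeff R G a ∈ realSubring R G :=
  Subring.subset_closure (.inl ⟨a, rfl⟩)

lemma vert_mem_real (v : V) : vert R G v ∈ realSubring R G :=
  Subring.subset_closure (.inr (.inl ⟨v, rfl⟩))

lemma edge_mem_real (e : E) : edge R G e ∈ realSubring R G :=
  Subring.subset_closure (.inr (.inr ⟨e, rfl⟩))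

/-- The scalar acts as an augmentation of `y`: edges and vertices other than `s(e)` contribute `0`,
and `s(e)` contributes `1`. This replaces a normal form for real elements. -/
lemma ghost_mul_real (e : E) {y : LeavittPathAlgebra R G} (hy : y ∈ realSubring R G) :
    ∃ a, ghost R G e * y - coeff R G a * ghost R G e ∈ realSubring R G := by
  induction hy using Subring.closure_induction with
  | mem y hy =>
    rcases hy with ⟨a, rfl⟩ | ⟨v, rfl⟩ | ⟨f, rfl⟩
    · exact ⟨a, by simp [(commute_coeff_ghost a e).eq]⟩
    · by_cases h : G.s e = v
      · subst h
        exact ⟨1, by simp [ghost_mul_source]⟩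
      · exact ⟨0, by simp [ghost_mul_vert h]⟩
    · refine ⟨0, ?_⟩
      rw [map_zero, zero_mul, sub_zero]
      by_cases h : e = f
      · subst h
        rw [ghost_mul_edge_self]
        exact vert_mem_real _
      · rw [ghost_mul_edge R G h]
        exact Subring.zero_mem _
  | zero => exact ⟨0, by simp⟩
  | one => exact ⟨1, by simp⟩
  | add y z _ _ ihy ihz =>
    obtain ⟨a, ha⟩ := ihy
    obtain ⟨b, hb⟩ := ihz
    refine ⟨a + b, ?_⟩
    convert Subring.add_mem _ ha hb using 1
    rw [map_add]
    noncomm_ring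
  | neg y _ ih =>
    obtain ⟨a, ha⟩ := ih
    refine ⟨-a, ?_⟩
    convert Subring.neg_mem _ ha using 1
    rw [map_neg]
    noncomm_ring
  | mul y z _ hz ihy ihz =>
    obtain ⟨a, ha⟩ := ihy
    obtain ⟨b, hb⟩ := ihz
    refine ⟨a * b, ?_⟩
    -- `e*yz - ab e* = (e*y - a e*)z + a(e*z - b e*)`.
    convert Subring.add_mem _ (Subring.mul_mem _ ha hz)
      (Subring.mul_mem _ (coeff_mem_real a) hb) using 1
    rw [map_mul]
    noncomm_ring

variable (R G)

/-- The elements of the Leavitt path algebra that become real after right multiplication by any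
path of length `n`, or by a sink after a path of length less than `n`. -/
noncomputable def realAfter : ℕ → AddSubgroup (LeavittPathAlgebra R G)
  | 0 => (realSubring R G).toAddSubgroup
  | n + 1 =>
    (⨅ e, (realAfter n).comap (AddMonoidHom.mulRight (edge R G e))) ⊓
      ⨅ v : {v // ∀ e, G.s e ≠ v},
        (realSubring R G).toAddSubgroup.comap (AddMonoidHom.mulRight (vert R G v))

variable {R G}

lemma mem_realAfter_succ {n : ℕ} {y : LeavittPathAlgebra R G} : y ∈ realAfter R G (n + 1) ↔
    (∀ e, y * edge R G e ∈ realAfter R G n) ∧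
      ∀ v, (∀ e, G.s e ≠ v) → y * vert R G v ∈ realSubring R G := by
  simp [realAfter, AddSubgroup.mem_inf, AddSubgroup.mem_iInf]

lemma realAfter_le_succ (n : ℕ) : realAfter R G n ≤ realAfter R G (n + 1) := by
  induction n with
  | zero =>
    intro y hy
    exact mem_realAfter_succ.mpr ⟨fun e => Subring.mul_mem _ hy (edge_mem_real e),
      fun v _ => Subring.mul_mem _ hy (vert_mem_real v)⟩
  | succ n ih =>
    intro y hy
    rw [mem_realAfter_succ] at hy ⊢
    exact ⟨fun e => ih (hy.1 e), hy.2⟩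

lemma realAfter_mono : Monotone (realAfter R G) := monotone_nat_of_le_succ realAfter_le_succ

lemma real_mul_mem_realAfter {y z : LeavittPathAlgebra R G} (hy : y ∈ realSubring R G) {n : ℕ}
    (hz : z ∈ realAfter R G n) : y * z ∈ realAfter R G n := by
  induction n generalizing z with
  | zero => exact Subring.mul_mem _ hy hz
  | succ n ih =>
    rw [mem_realAfter_succ] at hz ⊢
    refine ⟨fun e => ?_, fun v hv => ?_⟩
    · rw [mul_assoc]
      exact ih (hz.1 e)
    · rw [mul_assoc]
      exact Subring.mul_mem _ hy (hz.2 v hv)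

lemma ghost_mul_mul_mem_real (e : E) {y z : LeavittPathAlgebra R G} (hy : y ∈ realSubring R G)
    (hz : z ∈ realSubring R G) (hez : ghost R G e * z ∈ realSubring R G) :
    ghost R G e * y * z ∈ realSubring R G := by
  obtain ⟨a, ha⟩ := ghost_mul_real e hy
  convert Subring.add_mem _ (Subring.mul_mem _ ha hz)
    (Subring.mul_mem _ (coeff_mem_real a) hez) using 1
  noncomm_ring

lemma ghost_mul_edge_mem_real (e f : E) : ghost R G e * edge R G f ∈ realSubring R G := by
  by_cases h : e = f
  · subst h
    rw [ghost_mul_edge_self]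
    exact vert_mem_real _
  · rw [ghost_mul_edge R G h]
    exact Subring.zero_mem _

lemma ghost_mul_sink_mem_real (e : E) {v : V} (hv : ∀ e, G.s e ≠ v) :
    ghost R G e * vert R G v ∈ realSubring R G := by
  rw [ghost_mul_vert (hv e)]
  exact Subring.zero_mem _

/-- The only non-real remainder of `e*` times a real element is a multiple of `e*`, which one more
edge or a sink absorbs; hence the cost of one level. -/
lemma ghost_mul_mem_realAfter (e : E) {n : ℕ} {y : LeavittPathAlgebra R G}
    (hy : y ∈ realAfter R G n) : ghost R G e * y ∈ realAfter R G (n + 1) := by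
  induction n generalizing y with
  | zero =>
    refine mem_realAfter_succ.mpr ⟨fun f => ?_, fun v hv => ?_⟩
    · exact ghost_mul_mul_mem_real e hy (edge_mem_real f) (ghost_mul_edge_mem_real e f)
    · exact ghost_mul_mul_mem_real e hy (vert_mem_real v) (ghost_mul_sink_mem_real e hv)
  | succ n ih =>
    rw [mem_realAfter_succ] at hy ⊢
    refine ⟨fun f => ?_, fun v hv => ?_⟩
    · rw [mul_assoc]
      exact ih (hy.1 f)
    -- Since `v = v v`, a second copy of the sink is available to absorb the leftover `e*`.
    · have := ghost_mul_mul_mem_real e (hy.2 v hv) (vert_mem_real v)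
        (ghost_mul_sink_mem_real e hv)
      rwa [mul_assoc, mul_assoc, vert_mul_self, ← mul_assoc] at this

variable (R G) in
/-- The elements multiplication by which raises the level of `realAfter` boundedly. -/
def boundedShift : Subring (LeavittPathAlgebra R G) where
  carrier := {y | ∃ k, ∀ n, ∀ z ∈ realAfter R G n, y * z ∈ realAfter R G (n + k)}
  one_mem' := ⟨0, fun n z hz => by simpa using hz⟩
  zero_mem' := ⟨0, fun n z _ => by simp⟩
  add_mem' := by
    rintro y y' ⟨k, hk⟩ ⟨k', hk'⟩
    refine ⟨k + k', fun n z hz => ?_⟩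
    rw [add_mul]
    exact AddSubgroup.add_mem _ (realAfter_mono (by omega) (hk n z hz))
      (realAfter_mono (by omega) (hk' n z hz))
  neg_mem' := by
    rintro y ⟨k, hk⟩
    refine ⟨k, fun n z hz => ?_⟩
    rw [neg_mul]
    exact AddSubgroup.neg_mem _ (hk n z hz)
  mul_mem' := by
    rintro y y' ⟨k, hk⟩ ⟨k', hk'⟩
    refine ⟨k' + k, fun n z hz => ?_⟩
    rw [mul_assoc, ← add_assoc]
    exact hk _ _ (hk' n z hz)

lemma real_mem_boundedShift {y : LeavittPathAlgebra R G} (hy : y ∈ realSubring R G) :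
    y ∈ boundedShift R G := ⟨0, fun _ _ hz => real_mul_mem_realAfter hy hz⟩

/-- All generators shift levels boundedly, hence so does `y`; apply it to `1`, which lies at level
`0`. -/
lemma exists_mem_realAfter (y : LeavittPathAlgebra R G) : ∃ n, y ∈ realAfter R G n := by
  obtain ⟨k, hk⟩ : y ∈ boundedShift R G :=
    mem_of_generators_mem _ (fun a => real_mem_boundedShift (coeff_mem_real a))
      (fun v => real_mem_boundedShift (vert_mem_real v))
      (fun e => real_mem_boundedShift (edge_mem_real e))
      (fun e => ⟨1, fun _ _ hz => ghost_mul_mem_realAfter e hz⟩) y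
  exact ⟨0 + k, by simpa using hk 0 1 (Subring.one_mem _)⟩

/-- A homomorphism out of a Leavitt path algebra is injective if it is so on real elements. -/
lemma injective_of_injective_real {S : Type*} [Ring S] (φ : LeavittPathAlgebra R G →+* S)
    (h : ∀ y ∈ realSubring R G, φ y = 0 → y = 0) : Function.Injective φ := by
  rw [injective_iff_map_eq_zero]
  intro y hy
  obtain ⟨n, hn⟩ := exists_mem_realAfter y
  induction n generalizing y with
  | zero => exact h y hn hy
  | succ n ih =>
    rw [mem_realAfter_succ] at hn
    -- Split `y` over the vertices: `y v` is real at a sink, and otherwise is the sum of the `(y e)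
    -- e*` with `y e` one level lower.
    rw [← mul_one y, one_eq_sum, Finset.mul_sum]
    refine Finset.sum_eq_zero fun v _ => ?_
    by_cases hv : ∃ e, G.s e = v
    · rw [vert_eq_sum R G hv, Finset.mul_sum]
      refine Finset.sum_eq_zero fun e _ => ?_
      rw [← mul_assoc, ih (y * edge R G e) (by rw [map_mul, hy, zero_mul]) (hn.1 e), zero_mul]
    · exact h _ (hn.2 v (not_exists.mp hv)) (by rw [map_mul, hy, zero_mul])

/-! ### Real elements as combinations of walks. -/

variable (R G) in
/-- The path with source `u` and edges `p`, as an element of the Leavitt path algebra. -/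
noncomputable def path (u : V) (p : List E) : LeavittPathAlgebra R G :=
  vert R G u * (p.map (edge R G)).prod

lemma path_nil (u : V) : path R G u [] = vert R G u := by simp [path]

lemma vert_mul_path_self (u : V) (p : List E) : vert R G u * path R G u p = path R G u p := by
  rw [path, ← mul_assoc, vert_mul_self]

lemma vert_mul_path {u v : V} (h : v ≠ u) (p : List E) : vert R G v * path R G u p = 0 := by
  rw [path, ← mul_assoc, vert_mul_vert R G h, zero_mul]

lemma path_cons (e : E) (p : List E) :
    path R G (G.s e) (e :: p) = edge R G e * path R G (G.r e) p := by
  simp only [path, List.map_cons, List.prod_cons, ← mul_assoc, source_mul_edge, edge_mul_range]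

lemma edge_mul_path {e : E} {u : V} (h : G.r e ≠ u) (p : List E) :
    edge R G e * path R G u p = 0 := by
  rw [path, ← mul_assoc, edge_mul_vert h, zero_mul]

variable (R) in
/-- The `R`-linear combinations of walks ending at `v`. -/
noncomputable def walkSum (v : V) :
    ({q : V × List E // G.IsWalk q.1 q.2 v} →₀ R) →+ LeavittPathAlgebra R G :=
  Finsupp.liftAddHom fun q =>
    (AddMonoidHom.mulRight (path R G q.1.1 q.1.2)).comp (coeff R G).toAddMonoidHom

lemma walkSum_apply (v : V) (f : {q : V × List E // G.IsWalk q.1 q.2 v} →₀ R) :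
    walkSum R v f = f.sum fun q a => coeff R G a * path R G q.1.1 q.1.2 := rfl

lemma coeff_mul_path_mem {u v : V} {p : List E} (h : G.IsWalk u p v) (a : R) :
    coeff R G a * path R G u p ∈ (walkSum (G := G) R v).range :=
  ⟨Finsupp.single ⟨(u, p), h⟩ a, by rw [walkSum_apply, Finsupp.sum_single_index]; simp⟩

lemma mul_mem_of_path_mul_mem {v : V} {y z : LeavittPathAlgebra R G}
    (h : ∀ a u p, G.IsWalk u p v →
      y * (coeff R G a * path R G u p) ∈ (walkSum (G := G) R v).range)
    (hz : z ∈ (walkSum (G := G) R v).range) : y * z ∈ (walkSum (G := G) R v).range := by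
  obtain ⟨f, rfl⟩ := hz
  rw [walkSum_apply, Finsupp.sum, Finset.mul_sum]
  exact AddSubgroup.sum_mem _ fun q _ => h _ _ _ q.2

/-- Left multiplication by an edge extends a walk at its start or kills it, so the endpoint `v`
stays fixed. -/
lemma real_mul_mem_range_walkSum {y : LeavittPathAlgebra R G} (hy : y ∈ realSubring R G) {v : V}
    {z : LeavittPathAlgebra R G} (hz : z ∈ (walkSum (G := G) R v).range) :
    y * z ∈ (walkSum (G := G) R v).range := by
  induction hy using Subring.closure_induction generalizing z with
  | mem y hy =>
    refine mul_mem_of_path_mul_mem (fun a u p hp => ?_) hz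
    rcases hy with ⟨b, rfl⟩ | ⟨w, rfl⟩ | ⟨e, rfl⟩
    · rw [← mul_assoc, ← map_mul]
      exact coeff_mul_path_mem hp _
    · rw [← mul_assoc, ← (commute_coeff_vert a w).eq, mul_assoc]
      by_cases h : w = u
      · rw [h, vert_mul_path_self]
        exact coeff_mul_path_mem hp _
      · rw [vert_mul_path h, mul_zero]
        exact AddSubgroup.zero_mem _
    · rw [← mul_assoc, ← (commute_coeff_edge a e).eq, mul_assoc]
      by_cases h : G.r e = u
      · subst h
        rw [← path_cons]
        exact coeff_mul_path_mem (show G.IsWalk (G.s e) (e :: p) v from ⟨rfl, hp⟩) _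
      · rw [edge_mul_path h, mul_zero]
        exact AddSubgroup.zero_mem _
  | zero =>
    rw [zero_mul]
    exact AddSubgroup.zero_mem _
  | one => rwa [one_mul]
  | add y y' _ _ ih ih' =>
    rw [add_mul]
    exact AddSubgroup.add_mem _ (ih hz) (ih' hz)
  | neg y _ ih =>
    rw [neg_mul]
    exact AddSubgroup.neg_mem _ (ih hz)
  | mul y y' _ _ ih ih' =>
    rw [mul_assoc]
    exact ih (ih' hz)

lemma real_mul_vert_mem_range_walkSum {y : LeavittPathAlgebra R G} (hy : y ∈ realSubring R G)
    (v : V) : y * vert R G v ∈ (walkSum (G := G) R v).range := by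
  refine real_mul_mem_range_walkSum hy ?_
  have : G.IsWalk v [] v := rfl
  simpa [path_nil] using coeff_mul_path_mem this (1 : R)

end LeavittPathAlgebra

/-! ### Injectivity. -/

namespace PrefixCoding

open LeavittAlgebra

variable {R : Type*} [Ring R] {V E : Type*} [Fintype V] [DecidableEq V] [Fintype E]
  {G : DirGraph V E} (C : PrefixCoding R G)

/-- The factors telescope, as `z_{r(e)}* z_{r(e)} = 1` between consecutive edges. -/
lemma hom_path {u v : V} {p : List E} (h : G.IsWalk u p v) :
    C.hom (LeavittPathAlgebra.path R G u p) =
      word R (C.z u ++ C.pathWord p) * wordStar R (C.z v) := by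
  induction p generalizing u with
  | nil =>
    obtain rfl : u = v := h
    rw [LeavittPathAlgebra.path_nil]
    rw [LeavittPathAlgebra.vert, hom_mk_gen, genImage, pathWord, List.flatMap_nil, List.append_nil]
  | cons e p ih =>
    obtain ⟨rfl, hp⟩ := h
    rw [LeavittPathAlgebra.path_cons, map_mul, ih hp, LeavittPathAlgebra.edge, hom_mk_gen, genImage]
    simp only [pathWord, List.flatMap_cons, word_append, mul_assoc, wordStar_mul_word_mul_self]

/-- Under condition (L), the homomorphism defined by a prefix coding is injective. -/
theorem hom_injective (hL : G.ConditionL) : Function.Injective C.hom := by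
  refine LeavittPathAlgebra.injective_of_injective_real _ fun y hy h => ?_
  rw [← mul_one y, LeavittPathAlgebra.one_eq_sum, Finset.mul_sum]
  refine Finset.sum_eq_zero fun v _ => ?_
  obtain ⟨f, hf⟩ := LeavittPathAlgebra.real_mul_vert_mem_range_walkSum hy v
  -- All walks here end at `v`, so their images share the right factor `z_v*`, which `z_v` cancels.
  have h0 : C.hom (LeavittPathAlgebra.walkSum R v f) * word R (C.z v) = 0 := by
    rw [hf, map_mul, h, zero_mul, zero_mul]
  rw [LeavittPathAlgebra.walkSum_apply, Finsupp.sum, map_sum, Finset.sum_mul] at h0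
  have hf0 : f = 0 := by
    refine word_linearIndependent R _ (C.walkWord_injective hL v) f ?_
    rw [← h0, Finsupp.sum]
    refine Finset.sum_congr rfl fun q _ => ?_
    rw [map_mul, hom_coeff, C.hom_path q.2, mul_assoc, mul_assoc, wordStar_mul_word_self, mul_one]
  rw [← hf, hf0, map_zero]

end PrefixCoding

theorem theorem2p5 (k : Type*) [Field k] (R : Type*) [Ring R] [Algebra k R]
    {V E : Type*} [Fintype V] [DecidableEq V] [Fintype E]
    (G : DirGraph V E) (hL : G.ConditionL) :
    ∃ φ : LeavittPathAlgebra R G →ₙ+* LeavittAlgebra R,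
      Function.Injective φ ∧
      (∀ (a : R) (z : LeavittPathAlgebra R G),
        φ (LeavittPathAlgebra.coeff R G a * z) = LeavittAlgebra.coeff R a * φ z ∧
        φ (z * LeavittPathAlgebra.coeff R G a) = φ z * LeavittAlgebra.coeff R a) ∧
      (Nonempty V → φ 1 = 1) := by
  rcases isEmpty_or_nonempty V with hV | hV
  -- Without vertices the unit is an empty sum, so the algebra is zero and the zero map serves.
  · have h01 : (1 : LeavittPathAlgebra R G) = 0 := by
      rw [LeavittPathAlgebra.one_eq_sum, Finset.univ_eq_empty, Finset.sum_empty]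
    have : Subsingleton (LeavittPathAlgebra R G) := subsingleton_of_zero_eq_one h01.symm
    exact ⟨0, Function.injective_of_subsingleton _, by simp, fun h => (hV.false h.some).elim⟩
  · obtain ⟨C⟩ := PrefixCoding.exists_prefixCoding (R := R) (G := G)
    refine ⟨(C.hom : LeavittPathAlgebra R G →ₙ+* LeavittAlgebra R), C.hom_injective hL,
      fun a z => ⟨?_, ?_⟩, fun _ => map_one C.hom⟩
    · exact (map_mul C.hom _ _).trans (congrArg (· * C.hom z) (C.hom_coeff a))
    · exact (map_mul C.hom _ _).trans (congrArg (C.hom z * ·) (C.hom_coeff a))
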